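/- Let $R=\mathbb C((q))$ and $\widetilde R=\mathbb C[[q]]$. A $\mathbb C$-variation of Hodge structures (VHS) over $R$ is a finite-dimensional $\mathbb Z/2$-graded $R$-module $\mathcal V=\mathcal V_{ev}\oplus\mathcal V_{odd}$ with a connection on each summand (given by the $\mathbb C$-linear operator $\nabla_{d/dq}$ satisfying the Leibniz rule) and decreasing filtrations by $R$-submodules $\mathcal F^{\ge p}\mathcal V_{ev}$ ($p\in\mathbb Z$), $\mathcal F^{\ge p}\mathcal V_{odd}$ ($p\in\frac12+\mathbb Z$) with $\nabla_{d/dq}\mathcal F^{\ge p}\subset\mathcal F^{\ge p-1}$. It is polarised if it carries $R$-bilinear pairings $(\cdot,\cdot)$ on $\mathcal V_{ev}$ and on $\mathcal V_{odd}$ with $(\alpha,\beta)=(-1)^n(\beta,\alpha)$ for some $n\in\mathbb Z/2$, such that $(\mathcal F^{\ge p},\mathcal F^{\ge p'})=0$ for $p+p'>0$ and the induced pairings $Gr^p_{\mathcal F}\otimes Gr^{-p}_{\mathcal F}\to R$ are non-degenerate for all $p$. It is regular singular if it contains a lattice (a finitely generated $\widetilde R$-submodule spanning $\mathcal V$ over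 $R$) preserved by $\nabla_{q\,d/dq}=q\nabla_{d/dq}$. The Deligne lattice $\widetilde{\mathcal V}\subset\mathcal V$ of a regular singular VHS is the unique lattice preserved by $\nabla_{q\,d/dq}$ for which all eigenvalues of the residue, that is of the endomorphism of $\widetilde{\mathcal V}_0:=\widetilde{\mathcal V}/q\widetilde{\mathcal V}$ induced by $\nabla_{q\,d/dq}$, have real part in $[0,1)$. **Lemma.** Let $\mathcal V$ be a polarised VHS over $R$, let $k\in\frac12\mathbb Z$, and let $0\to\mathcal V\xrightarrow{a}\mathcal W\xrightarrow{b}R\to0$ be a short exact sequence of VHS (the maps are $R$-linear, respect the gradings and connections, and $0\to\mathcal F^{\ge p}\mathcal V\to\mathcal F^{\ge p}\mathcal W\to\mathcal F^{\ge p}R\to0$ is exact for all $p$), where $R$ has the connection $\nabla_{d/dq}=\frac{d}{dq}$, lies in the parity of $2k$, and has the filtration $\mathcal F^{\ge k}R=R$, $\mathcal F^{\ge k+1}R=0$. Assume that $\mathcal V$ and $\mathcal W$ are regular singular. Then $\mathcal V$ and $\mathcal W$ have unique Deligne lattices $\widetilde{\mathcal V}$ and $\widetilde{\mathcal W}$,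 one has $a(\widetilde{\mathcal V})\subset\widetilde{\mathcal W}$ and $b(\widetilde{\mathcal W})\subset\widetilde R$, and, with $N$ and $M$ the residues on $\widetilde{\mathcal V}_0$ and $\widetilde{\mathcal W}_0$, the induced residue sequence $$0\to(\widetilde{\mathcal V}_0,N)\to(\widetilde{\mathcal W}_0,M)\to(\mathbb C,0)\to0$$ is an exact sequence of $\mathbb C$-vector spaces with endomorphisms. Moreover, there exists $h\in\widetilde{\mathcal W}$ with $\nabla_{q\,d/dq}h=0$ and $b(h)=1$ if and only if this residue sequence splits as a sequence of $\mathbb C$-vector spaces with endomorphisms. -/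

import Mathlib

open scoped LaurentSeries PowerSeries Pointwise

noncomputable section

namespace FormalVHS

/-! ### The derivation `d/dq` of `ℂ((q))` -/

lemma coeff_derivative (f : ℂ⸨X⸩) (n : ℤ) :
    (LaurentSeries.derivative ℂ f).coeff n = ((n : ℂ) + 1) * f.coeff (n + 1) := by
  rw [LaurentSeries.derivative_apply, LaurentSeries.hasseDeriv_coeff]
  simp [zsmul_eq_mul]

lemma coeff_q_mul_derivative (f : ℂ⸨X⸩) (n : ℤ) :
    (HahnSeries.single (1 : ℤ) (1 : ℂ) * LaurentSeries.derivative ℂ f).coeff n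
      = (n : ℂ) * f.coeff n := by
  have h := HahnSeries.coeff_single_mul_add (r := (1 : ℂ))
    (x := LaurentSeries.derivative ℂ f) (a := n - 1) (b := (1 : ℤ))
  rw [sub_add_cancel, coeff_derivative, sub_add_cancel] at h
  rw [h]
  push_cast
  ring

/-- The Leibniz rule for `d/dq` on `ℂ((q))`. -/
lemma derivative_mul (f g : ℂ⸨X⸩) :
    LaurentSeries.derivative ℂ (f * g)
      = LaurentSeries.derivative ℂ f * g + f * LaurentSeries.derivative ℂ g := by
  have hq : (HahnSeries.single (1 : ℤ) (1 : ℂ) : ℂ⸨X⸩) ≠ 0 := by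
    simp
  refine mul_left_cancel₀ hq ?_
  set t : ℂ⸨X⸩ := HahnSeries.single (1 : ℤ) (1 : ℂ) with ht
  have e : t * (LaurentSeries.derivative ℂ f * g + f * LaurentSeries.derivative ℂ g)
      = (t * LaurentSeries.derivative ℂ f) * g + f * (t * LaurentSeries.derivative ℂ g) := by
    ring
  rw [e]
  have hsupp : ∀ h : ℂ⸨X⸩, (t * LaurentSeries.derivative ℂ h).support ⊆ h.support := by
    intro h n hn
    rw [HahnSeries.mem_support, ht, coeff_q_mul_derivative] at hn
    exact right_ne_zero_of_mul hn
  ext n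
  rw [HahnSeries.coeff_add', Pi.add_apply, ht, coeff_q_mul_derivative, ← ht,
    HahnSeries.coeff_mul, HahnSeries.coeff_mul_left' f.isPWO_support (hsupp f),
    HahnSeries.coeff_mul_right' g.isPWO_support (hsupp g), Finset.mul_sum,
    ← Finset.sum_add_distrib]
  refine Finset.sum_congr rfl fun ij hij => ?_
  obtain ⟨-, -, hsum⟩ := Finset.mem_antidiagonal.mp hij
  rw [ht, coeff_q_mul_derivative, coeff_q_mul_derivative, ← hsum]
  push_cast
  ring

/-! ### Variations of Hodge structures over the formal punctured disk

Throughout `V` is a module over `R = ℂ((q))`; the actions of `ℂ` and of `ℂ[[q]]` on it are the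
restrictions of the action of `ℂ((q))`, as the `IsScalarTower` hypotheses say. -/

/-- A `ℂ`-variation of Hodge structures over `R = ℂ((q))` with underlying `R`-module `V`
(free because `R` is a field).

* `part 0` and `part 1` are the even and the odd summand of `V`.
* `conn` is `∇_{d/dq}`, which is all of the connection; flatness is automatic, since the
  continuous derivations of `ℂ((q))` are spanned by `d/dq`.
* `Fil n` is `F^{≥ n/2}`, a submodule of `V_ev` if `n` is even and of `V_odd` if `n` is odd. -/
structure VHS (V : Type*) [AddCommGroup V] [Module ℂ V] [Module ℂ⸨X⸩ V] where
  finite : Module.Finite ℂ⸨X⸩ V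
  part : ZMod 2 → Submodule ℂ⸨X⸩ V
  isInternal : DirectSum.IsInternal part
  conn : V →ₗ[ℂ] V
  leibniz : ∀ (f : ℂ⸨X⸩) (v : V),
    conn (f • v) = LaurentSeries.derivative ℂ f • v + f • conn v
  conn_mem_part : ∀ (σ : ZMod 2) (v : V), v ∈ part σ → conn v ∈ part σ
  Fil : ℤ → Submodule ℂ⸨X⸩ V
  fil_le_part : ∀ n : ℤ, Fil n ≤ part (n : ZMod 2)
  fil_antitone : ∀ n : ℤ, Fil (n + 2) ≤ Fil n
  griffiths : ∀ (n : ℤ) (v : V), v ∈ Fil n → conn v ∈ Fil (n - 2)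

/-- A polarisation of a VHS. The two `R`-bilinear pairings on `V_ev` and on `V_odd` are given as
one pairing on `V` for which `V_ev` and `V_odd` are orthogonal. Non-degeneracy of the induced
pairing `Gr^p ⊗ Gr^{-p} → R`, with `p = n/2`, is stated on representatives. -/
structure VHS.Polarisation {V : Type*} [AddCommGroup V] [Module ℂ V] [Module ℂ⸨X⸩ V]
    (H : VHS V) where
  pairing : V →ₗ[ℂ⸨X⸩] V →ₗ[ℂ⸨X⸩] ℂ⸨X⸩
  orthogonal : ∀ σ τ : ZMod 2, σ ≠ τ → ∀ x ∈ H.part σ, ∀ y ∈ H.part τ, pairing x y = 0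
  sign : ∃ n : ℕ, ∀ x y : V, pairing x y = (-1) ^ n * pairing y x
  fil_orthogonal : ∀ i j : ℤ, 0 < i + j → ∀ x ∈ H.Fil i, ∀ y ∈ H.Fil j, pairing x y = 0
  nondegenerate_left : ∀ (n : ℤ), ∀ x ∈ H.Fil n,
    (∀ y ∈ H.Fil (-n), pairing x y = 0) → x ∈ H.Fil (n + 2)
  nondegenerate_right : ∀ (n : ℤ), ∀ y ∈ H.Fil (-n),
    (∀ x ∈ H.Fil n, pairing x y = 0) → y ∈ H.Fil (-n + 2)

/-- The VHS `R = ℂ((q))` with connection `d/dq` and filtration `F^{≥ k} R = R`,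
`F^{≥ k + 1} R = 0`, where `k = m/2`; it lies in the parity of `m`. -/
def trivialVHS (m : ℤ) : VHS ℂ⸨X⸩ where
  finite := inferInstance
  part σ := if σ = (m : ZMod 2) then ⊤ else ⊥
  isInternal := by
    rw [DirectSum.isInternal_submodule_iff_iSupIndep_and_iSup_eq_top]
    constructor
    · intro σ
      by_cases h : σ = (m : ZMod 2)
      · have : (⨆ (j : ZMod 2) (_ : j ≠ σ),
            (if j = (m : ZMod 2) then (⊤ : Submodule ℂ⸨X⸩ ℂ⸨X⸩) else ⊥)) = ⊥ := by
          simp only [iSup_eq_bot]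
          intro j hj
          rw [if_neg (fun e => hj (e.trans h.symm))]
        rw [this]
        exact disjoint_bot_right
      · simp only [if_neg h]
        exact disjoint_bot_left
    · refine top_unique ?_
      exact le_iSup_of_le (m : ZMod 2) (by rw [if_pos rfl])
  conn := LaurentSeries.derivative ℂ
  leibniz f v := derivative_mul f v
  conn_mem_part σ v hv := by
    by_cases h : σ = (m : ZMod 2)
    · rw [if_pos h]; trivial
    · rw [if_neg h, Submodule.mem_bot] at hv ⊢
      rw [hv, map_zero]
  Fil n := if (n : ZMod 2) = (m : ZMod 2) ∧ n ≤ m then ⊤ else ⊥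
  fil_le_part n := by
    by_cases h : (n : ZMod 2) = (m : ZMod 2)
    · rw [if_pos h]; exact le_top
    · rw [if_neg (fun h' => h h'.1)]; exact bot_le
  fil_antitone n := by
    have h2 : ((n + 2 : ℤ) : ZMod 2) = (n : ZMod 2) := by
      push_cast
      rw [show (2 : ZMod 2) = 0 from rfl, add_zero]
    by_cases h : ((n + 2 : ℤ) : ZMod 2) = (m : ZMod 2) ∧ n + 2 ≤ m
    · rw [if_pos h, if_pos ⟨h2 ▸ h.1, by omega⟩]
    · rw [if_neg h]; exact bot_le
  griffiths n v hv := by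
    have h2 : ((n - 2 : ℤ) : ZMod 2) = (n : ZMod 2) := by
      push_cast
      rw [show (2 : ZMod 2) = 0 from rfl, sub_zero]
    by_cases h : (n : ZMod 2) = (m : ZMod 2) ∧ n ≤ m
    · rw [if_pos ⟨h2.trans h.1, by omega⟩]; trivial
    · rw [if_neg h, Submodule.mem_bot] at hv
      rw [hv, map_zero]
      exact Submodule.zero_mem _

/-- `0 → V₁ → V₂ → V₃ → 0` is a short exact sequence of VHS: an exact sequence of modules, whose
maps commute with the connections, respect the `ℤ/2`-gradings, and for which the sequences
`0 → F^{≥ p} V₁ → F^{≥ p} V₂ → F^{≥ p} V₃ → 0` are exact. -/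
structure IsShortExact {V₁ V₂ V₃ : Type*}
    [AddCommGroup V₁] [Module ℂ V₁] [Module ℂ⸨X⸩ V₁]
    [AddCommGroup V₂] [Module ℂ V₂] [Module ℂ⸨X⸩ V₂]
    [AddCommGroup V₃] [Module ℂ V₃] [Module ℂ⸨X⸩ V₃]
    (H₁ : VHS V₁) (H₂ : VHS V₂) (H₃ : VHS V₃)
    (a : V₁ →ₗ[ℂ⸨X⸩] V₂) (b : V₂ →ₗ[ℂ⸨X⸩] V₃) : Prop where
  injective : Function.Injective a
  exact : Function.Exact a b
  surjective : Function.Surjective b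
  conn_left : ∀ v, a (H₁.conn v) = H₂.conn (a v)
  conn_right : ∀ w, b (H₂.conn w) = H₃.conn (b w)
  part_left : ∀ σ, (H₁.part σ).map a ≤ H₂.part σ
  part_right : ∀ σ, (H₂.part σ).map b ≤ H₃.part σ
  fil_left : ∀ n, (H₂.Fil n).comap a = H₁.Fil n
  fil_right : ∀ n, (H₂.Fil n).map b = H₃.Fil n

/-! ### Lattices, residues, the Deligne lattice -/

instance : IsScalarTower ℂ ℂ⟦X⟧ ℂ⸨X⸩ where
  smul_assoc c f g := by
    rw [Algebra.smul_def f g, Algebra.smul_def (c • f) g, PowerSeries.smul_eq_C_mul, map_mul,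
      LaurentSeries.coe_algebraMap, HahnSeries.ofPowerSeries_C, mul_assoc,
      HahnSeries.C_mul_eq_smul]

section Lattice

variable {V : Type*} [AddCommGroup V] [Module ℂ V] [Module ℂ⟦X⟧ V] [Module ℂ⸨X⸩ V]
  [IsScalarTower ℂ ℂ⟦X⟧ V] [IsScalarTower ℂ⟦X⟧ ℂ⸨X⸩ V]

/-- The operator `∇_{q d/dq} = q ∇_{d/dq}`. -/
def VHS.euler (H : VHS V) : V →ₗ[ℂ] V :=
  Module.toModuleEnd ℂ (S := ℂ⟦X⟧) V PowerSeries.X ∘ₗ H.conn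

lemma VHS.euler_apply (H : VHS V) (v : V) :
    H.euler v = (PowerSeries.X : ℂ⟦X⟧) • H.conn v := rfl

lemma derivative_X :
    LaurentSeries.derivative ℂ (algebraMap ℂ⟦X⟧ ℂ⸨X⸩ PowerSeries.X) = 1 := by
  rw [LaurentSeries.coe_algebraMap, HahnSeries.ofPowerSeries_X, LaurentSeries.derivative_apply,
    LaurentSeries.hasseDeriv_single]
  simp

/-- `∇_{q d/dq} (q v) = q (v + ∇_{q d/dq} v)`. -/
lemma VHS.euler_X_smul (H : VHS V) (v : V) :
    H.euler ((PowerSeries.X : ℂ⟦X⟧) • v) = (PowerSeries.X : ℂ⟦X⟧) • (v + H.euler v) := by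
  have h := H.leibniz (algebraMap ℂ⟦X⟧ ℂ⸨X⸩ PowerSeries.X) v
  rw [derivative_X, algebraMap_smul, algebraMap_smul, one_smul] at h
  rw [H.euler_apply, H.euler_apply, h]

/-- The fibre `L₀ = L/qL` at `q = 0` of a `ℂ[[q]]`-submodule `L` of `V`. -/
abbrev Fibre (L : Submodule ℂ⟦X⟧ V) : Type _ :=
  QuotSMulTop (PowerSeries.X : ℂ⟦X⟧) L

/-- The class in `L/qL` of an element of `L`. -/
abbrev toFibre (L : Submodule ℂ⟦X⟧ V) (v : L) : Fibre L :=
  Submodule.Quotient.mk v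

/-- The operator `∇_{q d/dq}` on a submodule that it preserves. -/
def VHS.eulerOn (H : VHS V) (L : Submodule ℂ⟦X⟧ V) (hL : ∀ v ∈ L, H.euler v ∈ L) :
    L →ₗ[ℂ] L where
  toFun v := ⟨H.euler v, hL v v.2⟩
  map_add' v w := Subtype.ext (map_add H.euler (v : V) w)
  map_smul' c v := Subtype.ext (map_smul H.euler c (v : V))

/-- The residue of the connection: the endomorphism of `L/qL` induced by `∇_{q d/dq}`. -/
def VHS.residue (H : VHS V) (L : Submodule ℂ⟦X⟧ V) (hL : ∀ v ∈ L, H.euler v ∈ L) :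
    Module.End ℂ (Fibre L) :=
  Submodule.mapQ
    (((PowerSeries.X : ℂ⟦X⟧) • (⊤ : Submodule ℂ⟦X⟧ L)).restrictScalars ℂ)
    (((PowerSeries.X : ℂ⟦X⟧) • (⊤ : Submodule ℂ⟦X⟧ L)).restrictScalars ℂ)
    (H.eulerOn L hL) (by
      rintro _ ⟨v, -, rfl⟩
      exact ⟨v + H.eulerOn L hL v, trivial, Subtype.ext (H.euler_X_smul (v : V)).symm⟩)

lemma VHS.residue_toFibre (H : VHS V) (L : Submodule ℂ⟦X⟧ V) (hL : ∀ v ∈ L, H.euler v ∈ L)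
    (v : L) : H.residue L hL (toFibre L v) = toFibre L ⟨H.euler v, hL v v.2⟩ := rfl

/-- A VHS is regular singular if it has a `ℂ[[q]]`-lattice (a finitely generated submodule that
spans `V` over `ℂ((q))`) which is preserved by `∇_{q d/dq}`. -/
def VHS.IsRegularSingular (H : VHS V) : Prop :=
  ∃ L : Submodule ℂ⟦X⟧ V, Submodule.IsLattice ℂ⸨X⸩ L ∧ ∀ v ∈ L, H.euler v ∈ L

/-- `L` is the Deligne lattice: a lattice preserved by `∇_{q d/dq}` such that all eigenvalues of
the residue have real part in `[0, 1)`. -/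
structure VHS.IsDeligneLattice (H : VHS V) (L : Submodule ℂ⟦X⟧ V) : Prop where
  isLattice : Submodule.IsLattice ℂ⸨X⸩ L
  stable : ∀ v ∈ L, H.euler v ∈ L
  re_eigenvalue : ∀ z : ℂ, (H.residue L stable).HasEigenvalue z → 0 ≤ z.re ∧ z.re < 1

/-- The submodule `ℂ[[q]]` of `ℂ((q))`. -/
def integers : Submodule ℂ⟦X⟧ ℂ⸨X⸩ :=
  LinearMap.range (Algebra.linearMap ℂ⟦X⟧ ℂ⸨X⸩)

/-- The map `L₀ → ℂ` of fibres at `q = 0` induced by a map `b : V → ℂ((q))` with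
`b(L) ⊆ ℂ[[q]]`. It sends the class of `w` to the constant coefficient `b(w)(0)`. -/
def fibreMapToC (b : V →ₗ[ℂ⸨X⸩] ℂ⸨X⸩) (L : Submodule ℂ⟦X⟧ V)
    (hb : ∀ w ∈ L, b w ∈ integers) : Fibre L →ₗ[ℂ] ℂ :=
  Submodule.liftQ
    (((PowerSeries.X : ℂ⟦X⟧) • (⊤ : Submodule ℂ⟦X⟧ L)).restrictScalars ℂ)
    { toFun := fun w : L => (b w).coeff 0
      map_add' := fun v w => by simp
      map_smul' := fun c w => by
        have h : ((c • w : L) : V) = HahnSeries.C (Γ := ℤ) c • (w : V) := by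
          rw [← HahnSeries.ofPowerSeries_C, ← LaurentSeries.coe_algebraMap, algebraMap_smul,
            ← PowerSeries.algebraMap_eq, algebraMap_smul]
          rfl
        rw [h, map_smul, smul_eq_mul, HahnSeries.C_mul_eq_smul, HahnSeries.coeff_smul]
        rfl }
    (by
      rintro _ ⟨v, -, rfl⟩
      obtain ⟨f, hf⟩ := hb v v.2
      have hv : b ((PowerSeries.X : ℂ⟦X⟧) • (v : V))
          = algebraMap ℂ⟦X⟧ ℂ⸨X⸩ (PowerSeries.X * f) := by
        rw [← algebraMap_smul ℂ⸨X⸩ (PowerSeries.X : ℂ⟦X⟧) (v : V), map_smul, ← hf, map_mul]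
        rfl
      change (b ((PowerSeries.X : ℂ⟦X⟧) • (v : V))).coeff 0 = 0
      rw [hv, LaurentSeries.coe_algebraMap]
      have h0 := LaurentSeries.coeff_coe_powerSeries (PowerSeries.X * f) 0
      simpa using h0)

lemma fibreMapToC_toFibre (b : V →ₗ[ℂ⸨X⸩] ℂ⸨X⸩) (L : Submodule ℂ⟦X⟧ V)
    (hb : ∀ w ∈ L, b w ∈ integers) (w : L) :
    fibreMapToC b L hb (toFibre L w) = (b w).coeff 0 := rfl

variable {W : Type*} [AddCommGroup W] [Module ℂ W] [Module ℂ⟦X⟧ W] [Module ℂ⸨X⸩ W]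
  [IsScalarTower ℂ ℂ⟦X⟧ W] [IsScalarTower ℂ⟦X⟧ ℂ⸨X⸩ W]

/-- The map of fibres `L₀ → L'₀` induced by a map `a : V → W` with `a(L) ⊆ L'`. -/
def fibreMap (a : V →ₗ[ℂ⸨X⸩] W) (L : Submodule ℂ⟦X⟧ V) (L' : Submodule ℂ⟦X⟧ W)
    (ha : ∀ v ∈ L, a v ∈ L') : Fibre L →ₗ[ℂ] Fibre L' :=
  (QuotSMulTop.map (PowerSeries.X : ℂ⟦X⟧)
    ((a.restrictScalars ℂ⟦X⟧).restrict ha)).restrictScalars ℂ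

lemma fibreMap_toFibre (a : V →ₗ[ℂ⸨X⸩] W) (L : Submodule ℂ⟦X⟧ V) (L' : Submodule ℂ⟦X⟧ W)
    (ha : ∀ v ∈ L, a v ∈ L') (v : L) :
    fibreMap a L L' ha (toFibre L v) = toFibre L' ⟨a v, ha v v.2⟩ := rfl

end Lattice

/-! ### Vector spaces with endomorphisms -/

section Endo

variable {A B C : Type*} [AddCommGroup A] [Module ℂ A] [AddCommGroup B] [Module ℂ B]
  [AddCommGroup C] [Module ℂ C]

/-- `0 → (A, N) → (B, M) → (C, P) → 0` is an exact sequence of vector spaces with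
endomorphisms. -/
structure IsExactEndo (N : Module.End ℂ A) (M : Module.End ℂ B) (P : Module.End ℂ C)
    (i : A →ₗ[ℂ] B) (p : B →ₗ[ℂ] C) : Prop where
  injective : Function.Injective i
  exact : Function.Exact i p
  surjective : Function.Surjective p
  comm_left : i ∘ₗ N = M ∘ₗ i
  comm_right : p ∘ₗ M = P ∘ₗ p

/-- The surjection `(B, M) → (C, P)` of a short exact sequence of vector spaces with endomorphisms
has a section that is a morphism of vector spaces with endomorphisms; that is, the sequence
splits. -/
def SplitsEndo (M : Module.End ℂ B) (P : Module.End ℂ C) (p : B →ₗ[ℂ] C) : Prop :=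
  ∃ s : C →ₗ[ℂ] B, p ∘ₗ s = LinearMap.id ∧ M ∘ₗ s = s ∘ₗ P

end Endo

end FormalVHS

end

/-! Write D for `∇_{q d/dq}` and call the residue eigenvalues of a D-stable lattice its exponents.
Everything follows from comparing exponents, using D(qⁿv) = qⁿ(Dv + nv).

Existence: rescaling by a power of q makes all real parts negative. Elementary modifications then
raise the negative ones by one until all lie in [0, 1).

Functoriality (`VHS.IsDeligneLattice.map_mem`): if q^(n+1)·a maps one Deligne lattice into another,
then on fibres it intertwines N with M - (n+1). These have no common eigenvalue, so the fibre map
vanishes and already qⁿ·a preserves the lattices; descend to n = 0. Applied to the identity, this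
gives uniqueness. The preimage of a Deligne lattice under `a` and its image under `b` satisfy the
defining conditions, so by uniqueness they are the Deligne lattices (`comap_eq`, `map_eq`). Thus the
lattices form an exact sequence, which stays exact modulo q.

Splitting: a flat h reduces to an invariant vector over 1. Conversely, such a vector lifts to w with
Dw in q times the lattice. A correction w + qu is flat once (1 + D)u has a prescribed value, and
this is solved order by order in q because no negative integer is an exponent
(`exists_add_euler_eq`). The image of a flat vector in ℂ((q)) is a constant, determined at q = 0. -/

/-! ### Eigenvalues of endomorphisms -/

namespace Module.End

section Eigenvalues

variable {K E F : Type*} [Field K] [AddCommGroup E] [Module K E] [AddCommGroup F] [Module K F]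

/-- An eigenvalue of a quotient of a finite-dimensional vector space with endomorphism is an
eigenvalue of the endomorphism. -/
theorem HasEigenvalue.of_surjective [FiniteDimensional K E] {φ : E →ₗ[K] F}
    (hφ : Function.Surjective φ) {N : End K E} {M : End K F} (h : ∀ x, φ (N x) = M (φ x)) {z : K}
    (hz : M.HasEigenvalue z) : N.HasEigenvalue z := by
  have : FiniteDimensional K F := Module.Finite.of_surjective φ hφ
  -- Otherwise N - z is injective, hence surjective. Surjectivity passes to the quotient, where it
  -- gives back injectivity.
  by_contra hN
  have hinj : Function.Injective (N - z • (1 : End K E)) := by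
    rw [← LinearMap.ker_eq_bot, ← eigenspace_def]
    simpa [hasEigenvalue_iff] using hN
  have hsurj := LinearMap.injective_iff_surjective.mp hinj
  have hM : Function.Surjective (M - z • (1 : End K F)) := by
    intro y
    obtain ⟨x, rfl⟩ := hφ y
    obtain ⟨x, rfl⟩ := hsurj x
    exact ⟨φ x, by simp [h]⟩
  have := LinearMap.injective_iff_surjective.mpr hM
  rw [← LinearMap.ker_eq_bot, ← eigenspace_def] at this
  exact hz this

/-- A morphism between vector spaces with endomorphisms that have no common eigenvalue is zero. -/
theorem eq_zero_of_disjoint_eigenvalues [IsAlgClosed K] [FiniteDimensional K E]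
    {φ : E →ₗ[K] F} {N : End K E} {M : End K F} (h : ∀ x, φ (N x) = M (φ x))
    (hd : ∀ z, N.HasEigenvalue z → ¬ M.HasEigenvalue z) : φ = 0 := by
  -- A nonzero range is both a quotient of E and an M-stable subspace of F, so an eigenvalue on it
  -- is shared by N and M.
  rw [← LinearMap.range_eq_bot]
  by_contra hne
  have : Nontrivial (LinearMap.range φ) := Submodule.nontrivial_iff_ne_bot.mpr hne
  have hM : ∀ x ∈ LinearMap.range φ, M x ∈ LinearMap.range φ := by
    rintro _ ⟨x, rfl⟩
    exact ⟨N x, h x⟩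
  obtain ⟨z, hz⟩ := exists_eigenvalue (M.restrict hM)
  refine hd z (hz.of_surjective (N := N) (M := M.restrict hM) φ.surjective_rangeRestrict fun x => Subtype.ext (h x)) ?_
  obtain ⟨v, hv⟩ := hz.exists_hasEigenvector
  refine hasEigenvalue_of_hasEigenvector (x := (v : F)) ⟨?_, ?_⟩
  · rw [mem_eigenspace_iff]
    exact congrArg Subtype.val hv.apply_eq_smul
  · simpa using hv.2

/-- The generalized eigenspaces with eigenvalues satisfying `P` span an invariant subspace on which
all eigenvalues satisfy `P`, and modulo which none does. -/
theorem exists_invariant_submodule [IsAlgClosed K] [FiniteDimensional K E] (N : End K E)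
    (P : K → Prop) :
    ∃ A : Submodule K E, (∀ x ∈ A, N x ∈ A) ∧ (∀ x ∈ A, ∀ z, N.HasEigenvector z x → P z) ∧
      ∀ x ∉ A, ∀ z, N x - z • x ∈ A → N.HasEigenvalue z ∧ ¬ P z := by
  let A : (K → Prop) → Submodule K E := fun Q => ⨆ z, ⨆ _ : Q z, N.maxGenEigenspace z
  have hinv (Q) : ∀ x ∈ A Q, N x ∈ A Q := by
    change A Q ≤ (A Q).comap N
    refine iSup₂_le fun z hz x hx => ?_
    exact Submodule.mem_iSup_of_mem z (Submodule.mem_iSup_of_mem hz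
      (mapsTo_maxGenEigenspace_of_comm (Commute.refl N) z hx))
  have heig (Q) : ∀ x ∈ A Q, ∀ z, N.HasEigenvector z x → Q z := by
    intro x hx z hz
    by_contra hQ
    have hle : A Q ≤ ⨆ w, ⨆ _ : w ≠ z, N.maxGenEigenspace w :=
      iSup₂_le fun w hw => le_iSup₂_of_le w (fun e => hQ (e ▸ hw)) le_rfl
    have hxz : x ∈ N.maxGenEigenspace z :=
      (mem_maxGenEigenspace N z x).mpr ⟨1, by simp [hz.apply_eq_smul]⟩
    exact hz.2 (Submodule.disjoint_def.mp (N.independent_maxGenEigenspace z) x hxz (hle hx))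
  have htop : A P ⊔ A (fun z => ¬ P z) = ⊤ := by
    rw [eq_top_iff, ← N.iSup_maxGenEigenspace_eq_top]
    refine iSup_le fun z => ?_
    by_cases hz : P z
    · exact le_sup_of_le_left (le_iSup₂_of_le z hz le_rfl)
    · exact le_sup_of_le_right (le_iSup₂_of_le (f := fun z (_ : ¬ P z) => N.maxGenEigenspace z)
        z hz le_rfl)
  -- An eigenvector in the intersection would have an eigenvalue both satisfying and violating P.
  have hdisj : A P ⊓ A (fun z => ¬ P z) = ⊥ := by
    by_contra hne
    have : Nontrivial ↥(A P ⊓ A (fun z => ¬ P z)) := Submodule.nontrivial_iff_ne_bot.mpr hne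
    have hN : ∀ x ∈ A P ⊓ A (fun z => ¬ P z), N x ∈ A P ⊓ A (fun z => ¬ P z) :=
      fun x hx => ⟨hinv _ x hx.1, hinv _ x hx.2⟩
    obtain ⟨z, hz⟩ := exists_eigenvalue (N.restrict hN)
    obtain ⟨v, hv⟩ := hz.exists_hasEigenvector
    have hv' : N.HasEigenvector z (v : E) :=
      ⟨mem_eigenspace_iff.mpr (congrArg Subtype.val hv.apply_eq_smul), by simpa using hv.2⟩
    exact heig _ _ v.2.2 z hv' (heig _ _ v.2.1 z hv')
  refine ⟨A P, hinv P, heig P, fun x hx z hxz => ?_⟩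
  -- Only the component y' in the complement matters modulo `A P`; there the eigenvector equation
  -- holds exactly.
  obtain ⟨y, hy, y', hy', rfl⟩ := Submodule.mem_sup.mp (htop ▸ Submodule.mem_top : x ∈ _)
  have hne : y' ≠ 0 := by
    rintro rfl
    exact hx (by simpa using hy)
  have hmem : N y' - z • y' ∈ A P := by
    have h1 : N y - z • y ∈ A P := sub_mem (hinv P y hy) (Submodule.smul_mem _ _ hy)
    have h2 := sub_mem hxz h1
    rwa [map_add, smul_add, show N y + N y' - (z • y + z • y') - (N y - z • y)
      = N y' - z • y' by abel] at h2
  have h0 : N y' - z • y' = 0 := by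
    rw [← Submodule.mem_bot K, ← hdisj]
    exact ⟨hmem, sub_mem (hinv _ y' hy') (Submodule.smul_mem _ _ hy')⟩
  have hy'e : N.HasEigenvector z y' := ⟨mem_eigenspace_iff.mpr (sub_eq_zero.mp h0), hne⟩
  exact ⟨hasEigenvalue_of_hasEigenvector hy'e, heig _ y' hy' z hy'e⟩

end Eigenvalues

end Module.End

/-! ### `X`-adic series in finitely generated modules over power series -/

namespace PowerSeries

section Adic

variable {R : Type*} [CommRing R]

/-- The series `∑ Xⁿ fₙ` converges in `R⟦X⟧`. -/
theorem exists_X_adic_sum (f : ℕ → R⟦X⟧) :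
    ∃ F : R⟦X⟧, ∀ N, (X : R⟦X⟧) ^ N ∣ F - ∑ n ∈ Finset.range N, X ^ n * f n := by
  -- Only the terms with n ≤ k contribute to the coefficient of X^k.
  refine ⟨PowerSeries.mk fun k => ∑ n ∈ Finset.range (k + 1), coeff (k - n) (f n), fun N => ?_⟩
  rw [X_pow_dvd_iff]
  intro m hm
  rw [map_sub, coeff_mk, map_sum, sub_eq_zero]
  simp only [coeff_X_pow_mul']
  rw [← Finset.sum_filter]
  refine Finset.sum_congr ?_ fun _ _ => rfl
  ext n
  simp only [Finset.mem_range, Finset.mem_filter]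
  omega

/-- The series `∑ Xⁿ xₙ` converges in a finitely generated `R⟦X⟧`-module. -/
theorem exists_X_adic_sum_module {M : Type*} [AddCommGroup M] [Module R⟦X⟧ M]
    [Module.Finite R⟦X⟧ M] (x : ℕ → M) :
    ∃ s : M, ∀ N, ∃ y : M, s = ∑ n ∈ Finset.range N, (X : R⟦X⟧) ^ n • x n + (X : R⟦X⟧) ^ N • y := by
  -- Lift to a finite free module, where the series is summed coordinatewise.
  obtain ⟨r, φ, hφ⟩ := Module.Finite.exists_fin' R⟦X⟧ M
  choose f hf using fun n => hφ (x n)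
  choose F hF using fun j => exists_X_adic_sum fun n => f n j
  refine ⟨φ F, fun N => ?_⟩
  choose g hg using fun j => hF j N
  refine ⟨φ g, ?_⟩
  have : F = ∑ n ∈ Finset.range N, (X : R⟦X⟧) ^ n • f n + (X : R⟦X⟧) ^ N • g := by
    ext1 j
    rw [Pi.add_apply, Finset.sum_apply, Pi.smul_apply, smul_eq_mul, ← hg j]
    simp
  rw [this, map_add, map_sum, map_smul]
  simp [hf]

/-- Finitely generated modules over `k⟦X⟧` are `X`-adically separated. -/
theorem eq_zero_of_forall_X_pow_smul {k : Type*} [Field k] {M : Type*} [AddCommGroup M]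
    [Module k⟦X⟧ M] [Module.Finite k⟦X⟧ M] (s : M)
    (h : ∀ N : ℕ, ∃ y : M, s = (X : k⟦X⟧) ^ N • y) : s = 0 := by
  -- This is Krull's intersection theorem; the maximal ideal is generated by X.
  have hH : IsHausdorff (IsLocalRing.maximalIdeal k⟦X⟧) M := inferInstance
  refine hH.haus s fun N => ?_
  obtain ⟨y, rfl⟩ := h N
  rw [SModEq.zero]
  refine Submodule.smul_mem_smul (Ideal.pow_mem_pow ?_ N) trivial
  rw [maximalIdeal_eq_span_X]
  exact Ideal.mem_span_singleton_self X

end Adic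

end PowerSeries

/-! ### Lattices -/

namespace FormalVHS

section Lattice

variable {V : Type*} [AddCommGroup V] [Module ℂ⟦X⟧ V]

lemma mem_X_smul {L : Submodule ℂ⟦X⟧ V} {v : V} :
    v ∈ (PowerSeries.X : ℂ⟦X⟧) • L ↔ ∃ u ∈ L, (PowerSeries.X : ℂ⟦X⟧) • u = v :=
  Submodule.mem_smul_pointwise_iff_exists _ _ _

lemma toFibre_eq_zero {L : Submodule ℂ⟦X⟧ V} {v : L} :
    toFibre L v = 0 ↔ (v : V) ∈ (PowerSeries.X : ℂ⟦X⟧) • L := by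
  rw [Submodule.Quotient.mk_eq_zero, Submodule.mem_smul_pointwise_iff_exists, mem_X_smul]
  constructor
  · rintro ⟨u, -, rfl⟩
    exact ⟨u, u.2, rfl⟩
  · rintro ⟨u, hu, h⟩
    exact ⟨⟨u, hu⟩, trivial, Subtype.ext h⟩

lemma toFibre_surjective (L : Submodule ℂ⟦X⟧ V) : Function.Surjective (toFibre L) :=
  Submodule.Quotient.mk_surjective _

/-- A power series acts on L/qL through its constant coefficient, so generators over ℂ⟦X⟧ also
generate over ℂ. -/
lemma finite_fibre [Module ℂ V] [IsScalarTower ℂ ℂ⟦X⟧ V] {L : Submodule ℂ⟦X⟧ V} (hL : L.FG) :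
    Module.Finite ℂ (Fibre L) := by
  have : Module.Finite ℂ⟦X⟧ L := Module.Finite.iff_fg.mpr hL
  obtain ⟨s, hs⟩ := (inferInstance : Module.Finite ℂ⟦X⟧ (Fibre L))
  refine ⟨s, ?_⟩
  rw [eq_top_iff]
  intro x _
  have hx : x ∈ Submodule.span ℂ⟦X⟧ (s : Set (Fibre L)) := hs ▸ Submodule.mem_top
  induction hx using Submodule.span_induction with
  | mem x hx => exact Submodule.subset_span hx
  | zero => exact Submodule.zero_mem _
  | add x y _ _ hx hy => exact add_mem (hx trivial) (hy trivial)
  | smul f x _ hx =>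
    obtain ⟨v, rfl⟩ := toFibre_surjective L x
    have : f • toFibre L v = PowerSeries.constantCoeff f • toFibre L v := by
      rw [← sub_eq_zero]
      refine toFibre_eq_zero (v := f • v - PowerSeries.constantCoeff f • v) |>.mpr ?_
      obtain ⟨g, hg⟩ := PowerSeries.X_dvd_iff.mpr
        (show PowerSeries.constantCoeff (f - PowerSeries.C (PowerSeries.constantCoeff f)) = 0 by
          simp)
      refine mem_X_smul.mpr ⟨g • v, L.smul_mem _ v.2, ?_⟩
      rw [smul_smul, ← hg, sub_smul]
      congr 1
      rw [← PowerSeries.algebraMap_eq, algebraMap_smul]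
      rfl
    rw [this]
    exact Submodule.smul_mem _ _ (hx trivial)

variable [Module ℂ⸨X⸩ V] [IsScalarTower ℂ⟦X⟧ ℂ⸨X⸩ V]

lemma X_pow_smul_bijective (n : ℕ) :
    Function.Bijective fun v : V => (PowerSeries.X : ℂ⟦X⟧) ^ n • v := by
  have hX : algebraMap ℂ⟦X⟧ ℂ⸨X⸩ (PowerSeries.X ^ n) ≠ 0 := by
    rw [Ne, FaithfulSMul.algebraMap_eq_zero_iff]
    exact pow_ne_zero _ PowerSeries.X_ne_zero
  simp only [← algebraMap_smul ℂ⸨X⸩ ((PowerSeries.X : ℂ⟦X⟧) ^ n)]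
  exact MulAction.bijective₀ hX

lemma X_smul_bijective : Function.Bijective fun v : V => (PowerSeries.X : ℂ⟦X⟧) • v := by
  simpa using X_pow_smul_bijective (V := V) 1

/-- Commensurability suffices: X^j embeds M into the Noetherian module L, and X^i is invertible in
ℂ((X)). -/
lemma isLattice_of_pow_smul_mem {L M : Submodule ℂ⟦X⟧ V} (hL : Submodule.IsLattice ℂ⸨X⸩ L)
    (i j : ℕ) (hLM : ∀ v ∈ L, (PowerSeries.X : ℂ⟦X⟧) ^ i • v ∈ M)
    (hML : ∀ v ∈ M, (PowerSeries.X : ℂ⟦X⟧) ^ j • v ∈ L) : Submodule.IsLattice ℂ⸨X⸩ M where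
  fg := by
    have : IsNoetherian ℂ⟦X⟧ L := isNoetherian_of_fg_of_noetherian L hL.fg
    refine Submodule.fg_of_fg_map_injective
      (LinearMap.lsmul ℂ⟦X⟧ V ((PowerSeries.X : ℂ⟦X⟧) ^ j)) (X_pow_smul_bijective j).1 ?_
    refine Submodule.FG.of_le hL.fg ?_
    rintro _ ⟨v, hv, rfl⟩
    exact hML v hv
  span_eq_top := by
    rw [eq_top_iff, ← hL.span_eq_top, Submodule.span_le]
    intro v hv
    have hX : algebraMap ℂ⟦X⟧ ℂ⸨X⸩ (PowerSeries.X ^ i) ≠ 0 := by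
      rw [Ne, FaithfulSMul.algebraMap_eq_zero_iff]
      exact pow_ne_zero _ PowerSeries.X_ne_zero
    have h : v = (algebraMap ℂ⟦X⟧ ℂ⸨X⸩ (PowerSeries.X ^ i))⁻¹ • ((PowerSeries.X : ℂ⟦X⟧) ^ i • v) := by
      rw [← algebraMap_smul ℂ⸨X⸩ ((PowerSeries.X : ℂ⟦X⟧) ^ i) v, inv_smul_smul₀ hX]
    rw [h]
    exact Submodule.smul_mem _ _ (Submodule.subset_span (hLM v hv))

lemma exists_X_pow_smul_mem {L : Submodule ℂ⟦X⟧ V} (hL : Submodule.IsLattice ℂ⸨X⸩ L) (w : V) :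
    ∃ n : ℕ, (PowerSeries.X : ℂ⟦X⟧) ^ n • w ∈ L := by
  have hw : w ∈ Submodule.span ℂ⸨X⸩ (L : Set V) := hL.span_eq_top ▸ Submodule.mem_top
  induction hw using Submodule.span_induction with
  | mem x hx => exact ⟨0, by simpa using hx⟩
  | zero => exact ⟨0, by simp⟩
  | add x y _ _ hx hy =>
    obtain ⟨i, hi⟩ := hx
    obtain ⟨j, hj⟩ := hy
    refine ⟨i + j, ?_⟩
    rw [smul_add]
    refine add_mem ?_ ?_
    · rw [add_comm, pow_add, mul_smul]
      exact L.smul_mem _ hi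
    · rw [pow_add, mul_smul]
      exact L.smul_mem _ hj
  | smul f x _ hx =>
    obtain ⟨i, hi⟩ := hx
    obtain ⟨⟨g, ⟨_, j, rfl⟩⟩, hg⟩ := IsLocalization.surj (Submonoid.powers (PowerSeries.X : ℂ⟦X⟧)) f
    refine ⟨j + i, ?_⟩
    have : (PowerSeries.X : ℂ⟦X⟧) ^ (j + i) • f • x = g • (PowerSeries.X : ℂ⟦X⟧) ^ i • x := by
      rw [← algebraMap_smul ℂ⸨X⸩ g, ← hg, pow_add, mul_smul,
        smul_comm ((PowerSeries.X : ℂ⟦X⟧) ^ i) f x, ← algebraMap_smul ℂ⸨X⸩ (PowerSeries.X ^ j : ℂ⟦X⟧),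
        smul_smul, mul_comm]
    rw [this]
    exact L.smul_mem _ hi

end Lattice

/-! ### Exponents of stable lattices -/

section Exponents

variable {V : Type*} [AddCommGroup V] [Module ℂ V] [Module ℂ⟦X⟧ V] [Module ℂ⸨X⸩ V]
  [IsScalarTower ℂ ℂ⟦X⟧ V] [IsScalarTower ℂ⟦X⟧ ℂ⸨X⸩ V]

lemma VHS.euler_X_pow_smul (H : VHS V) (n : ℕ) (v : V) :
    H.euler ((PowerSeries.X : ℂ⟦X⟧) ^ n • v)
      = (PowerSeries.X : ℂ⟦X⟧) ^ n • (H.euler v + (n : ℂ) • v) := by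
  induction n generalizing v with
  | zero => simp
  | succ n ih =>
    rw [pow_succ, mul_smul, ih, euler_X_smul, mul_smul]
    congr 1
    rw [smul_comm (n : ℂ), ← smul_add]
    congr 1
    push_cast
    rw [add_smul, one_smul]
    abel

/-- `z` is an eigenvalue of the endomorphism of `L/qL` induced by `∇_{q d/dq}`. -/
def VHS.IsExponent (H : VHS V) (L : Submodule ℂ⟦X⟧ V) (z : ℂ) : Prop :=
  ∃ v ∈ L, v ∉ (PowerSeries.X : ℂ⟦X⟧) • L ∧ H.euler v - z • v ∈ (PowerSeries.X : ℂ⟦X⟧) • L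

lemma VHS.residue_eq_smul_iff (H : VHS V) {L : Submodule ℂ⟦X⟧ V}
    (hL : ∀ v ∈ L, H.euler v ∈ L) {z : ℂ} {v : L} :
    H.residue L hL (toFibre L v) = z • toFibre L v
      ↔ H.euler v - z • (v : V) ∈ (PowerSeries.X : ℂ⟦X⟧) • L := by
  rw [← sub_eq_zero, VHS.residue_toFibre]
  exact toFibre_eq_zero (v := ⟨H.euler v, hL v v.2⟩ - z • v)

lemma VHS.residue_hasEigenvalue_iff (H : VHS V) {L : Submodule ℂ⟦X⟧ V}
    (hL : ∀ v ∈ L, H.euler v ∈ L) {z : ℂ} :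
    (H.residue L hL).HasEigenvalue z ↔ H.IsExponent L z := by
  constructor
  · intro h
    obtain ⟨x, hx⟩ := h.exists_hasEigenvector
    obtain ⟨v, rfl⟩ := toFibre_surjective L x
    exact ⟨v, v.2, fun h => hx.2 (toFibre_eq_zero.mpr h),
      (H.residue_eq_smul_iff hL).mp hx.apply_eq_smul⟩
  · rintro ⟨v, hv, hv0, hvz⟩
    refine Module.End.hasEigenvalue_of_hasEigenvector (x := toFibre L ⟨v, hv⟩)
      ⟨Module.End.mem_eigenspace_iff.mpr ((H.residue_eq_smul_iff hL).mpr hvz), fun h => ?_⟩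
    exact hv0 (toFibre_eq_zero.mp h)

/-- Exponents are phrased with vectors of V, so different lattices can be compared without passing
between their fibres. -/
lemma VHS.isDeligneLattice_iff (H : VHS V) {L : Submodule ℂ⟦X⟧ V} :
    H.IsDeligneLattice L ↔ Submodule.IsLattice ℂ⸨X⸩ L ∧ (∀ v ∈ L, H.euler v ∈ L) ∧
      ∀ z, H.IsExponent L z → 0 ≤ z.re ∧ z.re < 1 :=
  ⟨fun h => ⟨h.1, h.2, fun z hz => h.3 z ((H.residue_hasEigenvalue_iff h.2).mpr hz)⟩,
    fun h => ⟨h.1, h.2.1, fun z hz => h.2.2 z ((H.residue_hasEigenvalue_iff h.2.1).mp hz)⟩⟩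

/-! ### Existence of Deligne lattices -/

/-- Elementary modification of a stable lattice: the exponents with negative real part are
increased by one, the others are kept. -/
lemma VHS.exists_modification (H : VHS V) {L : Submodule ℂ⟦X⟧ V}
    (hL : Submodule.IsLattice ℂ⸨X⸩ L) (hs : ∀ v ∈ L, H.euler v ∈ L) :
    ∃ L' : Submodule ℂ⟦X⟧ V, Submodule.IsLattice ℂ⸨X⸩ L' ∧ (∀ v ∈ L', H.euler v ∈ L') ∧
      ∀ z, H.IsExponent L' z →
        (H.IsExponent L z ∧ 0 ≤ z.re) ∨ (H.IsExponent L (z - 1) ∧ (z - 1).re < 0) := by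
  have := finite_fibre hL.fg
  obtain ⟨A, hA, hAP, hAQ⟩ :=
    (H.residue L hs).exists_invariant_submodule (fun z => 0 ≤ z.re)
  have hX0 : ∀ v : L, toFibre L ((PowerSeries.X : ℂ⟦X⟧) • v) = 0 := fun v =>
    toFibre_eq_zero.mpr (mem_X_smul.mpr ⟨v, v.2, rfl⟩)
  have hsmul : ∀ (f : ℂ⟦X⟧) (v : L), toFibre L v ∈ A → toFibre L (f • v) ∈ A := by
    intro f v hv
    obtain ⟨g, hg⟩ := PowerSeries.X_dvd_iff.mpr
      (show PowerSeries.constantCoeff (f - PowerSeries.C (PowerSeries.constantCoeff f)) = 0 by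
        simp)
    have h : f • v = PowerSeries.constantCoeff f • v + (PowerSeries.X : ℂ⟦X⟧) • (g • v) := by
      rw [smul_smul, ← hg, sub_smul, ← PowerSeries.algebraMap_eq, algebraMap_smul]
      abel
    have h' : toFibre L (f • v) = PowerSeries.constantCoeff f • toFibre L v := by
      rw [h]
      exact (congrArg (PowerSeries.constantCoeff f • toFibre L v + ·) (hX0 (g • v))).trans
        (add_zero _)
    rw [h']
    exact A.smul_mem _ hv
  -- The modified lattice is the preimage of A; it lies between qL and L.
  let B : Submodule ℂ⟦X⟧ L :=
    { carrier := {v | toFibre L v ∈ A}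
      add_mem' := fun hv hw => A.add_mem hv hw
      zero_mem' := A.zero_mem
      smul_mem' := fun f v hv => hsmul f v hv }
  have hB : ∀ v : L, (v : V) ∈ B.map L.subtype ↔ toFibre L v ∈ A := by
    intro v
    constructor
    · rintro ⟨w, hw, h⟩
      rwa [← Subtype.ext (a1 := w) (a2 := v) h]
    · exact fun h => ⟨v, h, rfl⟩
  have hBL : ∀ v ∈ B.map L.subtype, v ∈ L := by
    rintro _ ⟨w, -, rfl⟩
    exact w.2
  have hXB : ∀ v ∈ L, (PowerSeries.X : ℂ⟦X⟧) • v ∈ B.map L.subtype := by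
    intro v hv
    refine (hB ((PowerSeries.X : ℂ⟦X⟧) • ⟨v, hv⟩)).mpr ?_
    rw [hX0]
    exact A.zero_mem
  refine ⟨B.map L.subtype, isLattice_of_pow_smul_mem hL 1 0 (by simpa using hXB)
    (by simpa using hBL), ?_, ?_⟩
  · intro v hv
    exact (hB ⟨H.euler v, hs v (hBL v hv)⟩).mpr (hA _ ((hB ⟨v, hBL v hv⟩).mp hv))
  · rintro z ⟨v, hv, hv0, hvz⟩
    obtain ⟨y, hy, hyv⟩ := mem_X_smul.mp hvz
    -- If v = qu, then u is an eigenvector modulo A with eigenvalue z - 1. Otherwise v gives an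
    -- eigenvector in A with eigenvalue z.
    by_cases hvL : v ∈ (PowerSeries.X : ℂ⟦X⟧) • L
    · right
      obtain ⟨u, hu, rfl⟩ := mem_X_smul.mp hvL
      have hy' : y = H.euler u - (z - 1) • u := by
        refine X_smul_bijective.1 ?_
        simp only
        rw [hyv, H.euler_X_smul, smul_comm z, ← smul_sub]
        congr 1
        rw [sub_smul, one_smul]
        abel
      have huA : toFibre L ⟨u, hu⟩ ∉ A := fun h =>
        hv0 (mem_X_smul.mpr ⟨u, (hB ⟨u, hu⟩).mpr h, rfl⟩)
      obtain ⟨h1, h2⟩ := hAQ _ huA (z - 1) (by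
        subst hy'
        exact (hB (⟨H.euler u, hs u hu⟩ - (z - 1) • ⟨u, hu⟩)).mp hy)
      exact ⟨(H.residue_hasEigenvalue_iff hs).mp h1, not_le.mp h2⟩
    · left
      have hz : H.euler v - z • v ∈ (PowerSeries.X : ℂ⟦X⟧) • L :=
        mem_X_smul.mpr ⟨y, hBL y hy, hyv⟩
      refine ⟨⟨v, hBL v hv, hvL, hz⟩, hAP _ ((hB ⟨v, hBL v hv⟩).mp hv) z
        ⟨Module.End.mem_eigenspace_iff.mpr ((H.residue_eq_smul_iff hs).mpr hz), fun h => ?_⟩⟩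
      exact hvL (toFibre_eq_zero.mp h)

/-- Passing from `L` to `q⁻ⁿL` subtracts `n` from the exponents. -/
lemma VHS.exists_shift (H : VHS V) {L : Submodule ℂ⟦X⟧ V}
    (hL : Submodule.IsLattice ℂ⸨X⸩ L) (hs : ∀ v ∈ L, H.euler v ∈ L) (n : ℕ) :
    ∃ L' : Submodule ℂ⟦X⟧ V, Submodule.IsLattice ℂ⸨X⸩ L' ∧ (∀ v ∈ L', H.euler v ∈ L') ∧
      ∀ z, H.IsExponent L' z → H.IsExponent L (z + n) := by
  let L' : Submodule ℂ⟦X⟧ V := L.comap (LinearMap.lsmul ℂ⟦X⟧ V ((PowerSeries.X : ℂ⟦X⟧) ^ n))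
  have hmem : ∀ v, v ∈ L' ↔ (PowerSeries.X : ℂ⟦X⟧) ^ n • v ∈ L := fun v => Iff.rfl
  have hXmem : ∀ v, (PowerSeries.X : ℂ⟦X⟧) ^ n • v ∈ (PowerSeries.X : ℂ⟦X⟧) • L ↔
      v ∈ (PowerSeries.X : ℂ⟦X⟧) • L' := by
    intro v
    obtain ⟨w, rfl⟩ := X_smul_bijective.2 v
    simp only
    rw [smul_comm]
    constructor
    · intro h
      obtain ⟨u, hu, hu'⟩ := mem_X_smul.mp h
      exact mem_X_smul.mpr ⟨w, by rw [hmem, ← X_smul_bijective.1 hu']; exact hu, rfl⟩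
    · intro h
      obtain ⟨u, hu, hu'⟩ := mem_X_smul.mp h
      rw [← X_smul_bijective.1 hu']
      exact mem_X_smul.mpr ⟨_, hu, rfl⟩
  refine ⟨L', isLattice_of_pow_smul_mem hL 0 n ?_ fun v hv => hv, ?_, ?_⟩
  · intro v hv
    rw [pow_zero, one_smul]
    exact L.smul_mem _ hv
  · intro v hv
    have h := sub_mem (hs _ hv) (Submodule.smul_of_tower_mem L (n : ℂ) hv)
    change H.euler ((PowerSeries.X : ℂ⟦X⟧) ^ n • v) - (n : ℂ) • (PowerSeries.X : ℂ⟦X⟧) ^ n • v ∈ L at h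
    rw [smul_comm (n : ℂ), H.euler_X_pow_smul, ← smul_sub, add_sub_cancel_right] at h
    exact h
  · rintro z ⟨v, hv, hv0, hvz⟩
    refine ⟨(PowerSeries.X : ℂ⟦X⟧) ^ n • v, hv, fun h => hv0 ((hXmem v).mp h), ?_⟩
    rw [← hXmem] at hvz
    rw [H.euler_X_pow_smul, smul_comm (z + n), ← smul_sub, add_smul, add_sub_add_right_eq_sub]
    exact hvz

theorem VHS.IsRegularSingular.exists_isDeligneLattice {H : VHS V} (h : H.IsRegularSingular) :
    ∃ L, H.IsDeligneLattice L := by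
  obtain ⟨L, hL, hs⟩ := h
  have hfin : {z | H.IsExponent L z}.Finite := by
    have := finite_fibre hL.fg
    refine ((H.residue L hs).finite_hasEigenvalue).subset fun z hz => ?_
    exact (H.residue_hasEigenvalue_iff hs).mpr hz
  obtain ⟨B, hB⟩ := (hfin.image fun z => |z.re|).bddAbove
  obtain ⟨n, hn⟩ := exists_nat_gt B
  have hbound : ∀ z, H.IsExponent L z → |z.re| < n := fun z hz =>
    (hB ⟨z, hz, rfl⟩).trans_lt hn
  -- Each modification narrows the strip -r ≤ Re z < 1 by one on the left without crossing 1 on the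
  -- right.
  have key : ∀ r : ℕ, ∀ L : Submodule ℂ⟦X⟧ V, Submodule.IsLattice ℂ⸨X⸩ L →
      (∀ v ∈ L, H.euler v ∈ L) → (∀ z, H.IsExponent L z → -(r : ℝ) ≤ z.re ∧ z.re < 1) →
      ∃ L, H.IsDeligneLattice L := by
    intro r
    induction r with
    | zero =>
      intro L hL hs hz
      exact ⟨L, H.isDeligneLattice_iff.mpr ⟨hL, hs, by simpa using hz⟩⟩
    | succ r ih =>
      intro L hL hs hz
      obtain ⟨L', hL', hs', hz'⟩ := H.exists_modification hL hs
      refine ih L' hL' hs' fun z hzL' => ?_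
      rcases hz' z hzL' with ⟨h1, h2⟩ | ⟨h1, h2⟩
      · exact ⟨le_trans (by simp) h2, (hz z h1).2⟩
      · have h3 := (hz _ h1).1
        simp only [Complex.sub_re, Complex.one_re, Nat.cast_add, Nat.cast_one] at h2 h3
        constructor <;> linarith
  obtain ⟨L', hL', hs', hz'⟩ := H.exists_shift hL hs n
  -- The original real parts lie in (-n, n), so the shifted ones lie in (-2n, 0).
  refine key (2 * n) L' hL' hs' fun z hz => ?_
  have := abs_lt.mp (hbound _ (hz' z hz))
  simp only [Complex.add_re, Complex.natCast_re] at this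
  push_cast
  constructor <;> linarith

end Exponents

end FormalVHS

/-! ### Deligne lattices and morphisms -/

namespace FormalVHS

section Morphisms

variable {V : Type*} [AddCommGroup V] [Module ℂ V] [Module ℂ⟦X⟧ V] [Module ℂ⸨X⸩ V]
  [IsScalarTower ℂ ℂ⟦X⟧ V] [IsScalarTower ℂ⟦X⟧ ℂ⸨X⸩ V]
  {W : Type*} [AddCommGroup W] [Module ℂ W] [Module ℂ⟦X⟧ W] [Module ℂ⸨X⸩ W]
  [IsScalarTower ℂ ℂ⟦X⟧ W] [IsScalarTower ℂ⟦X⟧ ℂ⸨X⸩ W]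
  {HV : VHS V} {HW : VHS W}

lemma map_complex_smul (a : V →ₗ[ℂ⸨X⸩] W) (z : ℂ) (v : V) : a (z • v) = z • a v := by
  rw [← algebraMap_smul ℂ⟦X⟧ z v, LinearMap.map_smul_of_tower, algebraMap_smul]

lemma map_euler_of_conn {a : V →ₗ[ℂ⸨X⸩] W} (ha : ∀ v, a (HV.conn v) = HW.conn (a v)) (v : V) :
    a (HV.euler v) = HW.euler (a v) := by
  rw [VHS.euler_apply, VHS.euler_apply, LinearMap.map_smul_of_tower, ha]

/-- A morphism of connections maps the Deligne lattice into the Deligne lattice. -/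
theorem VHS.IsDeligneLattice.map_mem {LV : Submodule ℂ⟦X⟧ V} {LW : Submodule ℂ⟦X⟧ W}
    (dV : HV.IsDeligneLattice LV) (dW : HW.IsDeligneLattice LW) {a : V →ₗ[ℂ⸨X⸩] W}
    (ha : ∀ v, a (HV.euler v) = HW.euler (a v)) : ∀ v ∈ LV, a v ∈ LW := by
  have hstep : ∀ n : ℕ, (∀ v ∈ LV, (PowerSeries.X : ℂ⟦X⟧) ^ n • a v ∈ LW) → ∀ v ∈ LV, a v ∈ LW := by
    intro n
    induction n with
    | zero => simp
    | succ n ih =>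
      intro h
      refine ih fun v hv => ?_
      have hfin := finite_fibre dV.isLattice.fg
      let b : V →ₗ[ℂ⸨X⸩] W := algebraMap ℂ⟦X⟧ ℂ⸨X⸩ (PowerSeries.X ^ (n + 1)) • a
      have hb : ∀ v, b v = (PowerSeries.X : ℂ⟦X⟧) ^ (n + 1) • a v := fun v =>
        algebraMap_smul ℂ⸨X⸩ _ (a v)
      have hbL : ∀ v ∈ LV, b v ∈ LW := fun v hv => hb v ▸ h v hv
      have hφ : fibreMap b LV LW hbL = 0 := by
        -- A common eigenvalue z would have Re z ≥ 0, while z + n + 1 would be an exponent of `LW`,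
        -- with real part below 1.
        refine Module.End.eq_zero_of_disjoint_eigenvalues (N := HV.residue LV dV.stable)
          (M := HW.residue LW dW.stable - ((n + 1 : ℕ) : ℂ) • 1) ?_ ?_
        · intro x
          obtain ⟨v, rfl⟩ := toFibre_surjective LV x
          rw [VHS.residue_toFibre, fibreMap_toFibre, fibreMap_toFibre, LinearMap.sub_apply,
            VHS.residue_toFibre]
          refine congrArg (toFibre LW) (a₂ := ⟨HW.euler (b v), _⟩ -
            ((n + 1 : ℕ) : ℂ) • ⟨b v, hbL v v.2⟩) (Subtype.ext ?_)
          change b (HV.euler v) = HW.euler (b v) - ((n + 1 : ℕ) : ℂ) • b v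
          rw [hb, hb, HW.euler_X_pow_smul, ha, smul_comm ((n + 1 : ℕ) : ℂ), ← smul_sub,
            add_sub_cancel_right]
        · intro z hz hz'
          have hz'' : (HW.residue LW dW.stable).HasEigenvalue (z + (n + 1 : ℕ)) := by
            obtain ⟨x, hx⟩ := hz'.exists_hasEigenvector
            refine Module.End.hasEigenvalue_of_hasEigenvector (x := x)
              ⟨Module.End.mem_eigenspace_iff.mpr ?_, hx.2⟩
            have := hx.apply_eq_smul
            rw [LinearMap.sub_apply, sub_eq_iff_eq_add] at this
            rw [this, add_smul]
            rfl
          have h1 := (dV.re_eigenvalue z hz).1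
          have h2 := (dW.re_eigenvalue _ hz'').2
          rw [Complex.add_re, Complex.natCast_re] at h2
          push_cast at h2
          have : (0 : ℝ) ≤ n := n.cast_nonneg
          linarith
      -- The vanishing fibre map puts the image of b in q`LW`, so one factor q cancels.
      have h0 : toFibre LW ⟨b v, hbL v hv⟩ = 0 := by
        rw [← fibreMap_toFibre b LV LW hbL ⟨v, hv⟩, hφ]
        rfl
      obtain ⟨u, hu, huv⟩ := mem_X_smul.mp (toFibre_eq_zero.mp h0)
      have : u = (PowerSeries.X : ℂ⟦X⟧) ^ n • a v := by
        refine X_smul_bijective.1 ?_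
        simp only
        rw [huv, smul_smul, ← pow_succ']
        exact hb v
      exact this ▸ hu
  obtain ⟨s, hs⟩ := dV.isLattice.fg
  choose n hn using fun v : V => exists_X_pow_smul_mem dW.isLattice (a v)
  -- The sum dominates each summand, so this single power of q serves all generators.
  refine hstep (∑ v ∈ s, n v) fun v hv => ?_
  rw [← hs] at hv
  induction hv using Submodule.span_induction with
  | mem x hx =>
    classical
    rw [← Finset.sum_erase_add s n hx, pow_add, mul_smul]
    exact LW.smul_mem _ (hn x)
  | zero => simp
  | add x y _ _ hx hy =>
    rw [map_add, smul_add]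
    exact add_mem hx hy
  | smul f x _ hx =>
    rw [LinearMap.map_smul_of_tower, smul_comm]
    exact LW.smul_mem _ hx

theorem VHS.IsDeligneLattice.eq {L L' : Submodule ℂ⟦X⟧ V} (d : HV.IsDeligneLattice L)
    (d' : HV.IsDeligneLattice L') : L = L' :=
  le_antisymm (d.map_mem d' (a := LinearMap.id) fun _ => rfl)
    (d'.map_mem d (a := LinearMap.id) fun _ => rfl)

theorem VHS.IsRegularSingular.existsUnique_isDeligneLattice (h : HV.IsRegularSingular) :
    ∃! L, HV.IsDeligneLattice L := by
  obtain ⟨L, d⟩ := h.exists_isDeligneLattice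
  exact ⟨L, d, fun L' d' => d'.eq d⟩

/-- The Deligne lattice of a subobject is the intersection with the Deligne lattice. -/
theorem VHS.IsDeligneLattice.comap_eq {LV : Submodule ℂ⟦X⟧ V} {LW : Submodule ℂ⟦X⟧ W}
    (dV : HV.IsDeligneLattice LV) (dW : HW.IsDeligneLattice LW) {a : V →ₗ[ℂ⸨X⸩] W}
    (ha : ∀ v, a (HV.euler v) = HW.euler (a v)) (hinj : Function.Injective a)
    (hsat : ∀ v w, a v = (PowerSeries.X : ℂ⟦X⟧) • w → ∃ v', a v' = w) :
    ∀ v, a v ∈ LW ↔ v ∈ LV := by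
  let L : Submodule ℂ⟦X⟧ V := LW.comap (a.restrictScalars ℂ⟦X⟧)
  have hL : ∀ v, v ∈ L ↔ a v ∈ LW := fun v => Iff.rfl
  have hle : LV ≤ L := dV.map_mem dW ha
  have d : HV.IsDeligneLattice L := by
    refine HV.isDeligneLattice_iff.mpr ⟨⟨?_, ?_⟩, ?_, ?_⟩
    · refine Submodule.fg_of_fg_map_injective (a.restrictScalars ℂ⟦X⟧) hinj ?_
      exact Submodule.FG.of_le dW.isLattice.fg (Submodule.map_comap_le _ _)
    · rw [eq_top_iff, ← dV.isLattice.span_eq_top]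
      exact Submodule.span_mono hle
    · intro v hv
      rw [hL, ha]
      exact dW.stable _ hv
    -- Saturation `hsat` keeps the class of `a v` nonzero in the fibre of `LW`, so z is an exponent
    -- of `LW`.
    · rintro z ⟨v, hv, hv0, hvz⟩
      refine (HW.isDeligneLattice_iff.mp dW).2.2 z ⟨a v, hv, fun h => hv0 ?_, ?_⟩
      · obtain ⟨w, hw, hwv⟩ := mem_X_smul.mp h
        obtain ⟨v', rfl⟩ := hsat v w hwv.symm
        refine mem_X_smul.mpr ⟨v', hw, hinj ?_⟩
        rw [LinearMap.map_smul_of_tower, hwv]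
      · obtain ⟨y, hy, hyv⟩ := mem_X_smul.mp hvz
        refine mem_X_smul.mpr ⟨a y, hy, ?_⟩
        rw [← LinearMap.map_smul_of_tower, hyv, map_sub, ha, map_complex_smul]
  intro v
  rw [dV.eq d]
  exact Iff.rfl

/-- The Deligne lattice of a quotient object is the image of the Deligne lattice. -/
theorem VHS.IsDeligneLattice.map_eq {LV : Submodule ℂ⟦X⟧ V} {LW : Submodule ℂ⟦X⟧ W}
    (dV : HV.IsDeligneLattice LV) (dW : HW.IsDeligneLattice LW) {b : V →ₗ[ℂ⸨X⸩] W}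
    (hb : ∀ v, b (HV.euler v) = HW.euler (b v)) (hsurj : Function.Surjective b) :
    ∀ w, w ∈ LW ↔ ∃ v ∈ LV, b v = w := by
  let L : Submodule ℂ⟦X⟧ W := LV.map (b.restrictScalars ℂ⟦X⟧)
  have hbL : ∀ v ∈ LV, b v ∈ L := fun v hv => ⟨v, hv, rfl⟩
  have hs : ∀ w ∈ L, HW.euler w ∈ L := by
    rintro _ ⟨v, hv, rfl⟩
    exact ⟨HV.euler v, dV.stable v hv, hb v⟩
  have hfin := finite_fibre dV.isLattice.fg
  have d : HW.IsDeligneLattice L := by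
    refine ⟨⟨dV.isLattice.fg.map _, ?_⟩, hs, fun z hz => dV.re_eigenvalue z ?_⟩
    · have h : Submodule.map b (Submodule.span ℂ⸨X⸩ (LV : Set V))
          = Submodule.span ℂ⸨X⸩ (L : Set W) := Submodule.map_span b _
      rw [← h, dV.isLattice.span_eq_top, Submodule.map_top, LinearMap.range_eq_top]
      exact hsurj
    -- The fibre of the image is a quotient of the fibre of `LV`, so no new exponents appear.
    · refine hz.of_surjective (φ := fibreMap b LV L hbL) ?_ ?_
      · intro x
        obtain ⟨⟨_, v, hv, rfl⟩, rfl⟩ := toFibre_surjective L x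
        exact ⟨toFibre LV ⟨v, hv⟩, rfl⟩
      · intro x
        obtain ⟨v, rfl⟩ := toFibre_surjective LV x
        exact congrArg (toFibre L) (Subtype.ext (hb v))
  intro w
  rw [dW.eq d]
  exact Iff.rfl

/-! ### Horizontal sections -/

/-- On a Deligne lattice `1 + ∇_{q d/dq}` is surjective. -/
theorem VHS.IsDeligneLattice.exists_add_euler_eq {L : Submodule ℂ⟦X⟧ V}
    (d : HV.IsDeligneLattice L) {y : V} (hy : y ∈ L) : ∃ u ∈ L, u + HV.euler u = y := by
  have hfin := finite_fibre d.isLattice.fg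
  have : Module.Finite ℂ⟦X⟧ L := Module.Finite.iff_fg.mpr d.isLattice.fg
  -- On qⁿx the operator 1 + D becomes qⁿ(D + n + 1)x. It can be solved modulo q since -(n+1) is not
  -- an exponent.
  have hstep : ∀ (n : ℕ) (r : L), ∃ x r' : L,
      r = HV.eulerOn L d.stable x + ((n + 1 : ℕ) : ℂ) • x + (PowerSeries.X : ℂ⟦X⟧) • r' := by
    intro n r
    set N := HV.residue L d.stable
    have hinj : Function.Injective (N + ((n + 1 : ℕ) : ℂ) • (1 : Module.End ℂ (Fibre L))) := by
      rw [injective_iff_map_eq_zero]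
      intro x hx
      by_contra hx0
      have := (d.re_eigenvalue (-((n + 1 : ℕ) : ℂ))
        (Module.End.hasEigenvalue_of_hasEigenvector (x := x)
          ⟨Module.End.mem_eigenspace_iff.mpr ?_, hx0⟩)).1
      · rw [Complex.neg_re, Complex.natCast_re] at this
        push_cast at this
        have h0 : (0 : ℝ) ≤ n := n.cast_nonneg
        linarith
      · rw [neg_smul]
        exact eq_neg_of_add_eq_zero_left hx
    obtain ⟨x, hx⟩ := LinearMap.injective_iff_surjective.mp hinj (toFibre L r)
    obtain ⟨x, rfl⟩ := toFibre_surjective L x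
    have h0 : toFibre L (r - (HV.eulerOn L d.stable x + ((n + 1 : ℕ) : ℂ) • x)) = 0 :=
      sub_eq_zero.mpr hx.symm
    obtain ⟨r', hr', h⟩ := mem_X_smul.mp (toFibre_eq_zero.mp h0)
    refine ⟨x, ⟨r', hr'⟩, ?_⟩
    rw [← sub_eq_iff_eq_add']
    exact Subtype.ext h.symm
  choose f g hfg using hstep
  -- r n is the remainder after n steps; the solution is the sum of the qⁿ · `f n (r n)`.
  let r : ℕ → L := fun n => Nat.rec ⟨y, hy⟩ g n
  have hr : ∀ n, r (n + 1) = g n (r n) := fun n => rfl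
  obtain ⟨s, hs⟩ := PowerSeries.exists_X_adic_sum_module (R := ℂ) fun n => f n (r n)
  have hD : ∀ (n : ℕ) (x : L), HV.eulerOn L d.stable ((PowerSeries.X : ℂ⟦X⟧) ^ n • x)
      = (PowerSeries.X : ℂ⟦X⟧) ^ n • (HV.eulerOn L d.stable x + (n : ℂ) • x) :=
    fun n x => Subtype.ext (HV.euler_X_pow_smul n (x : V))
  have hpart : ∀ N : ℕ, ∑ n ∈ Finset.range N, (PowerSeries.X : ℂ⟦X⟧) ^ n • f n (r n)
      + HV.eulerOn L d.stable (∑ n ∈ Finset.range N, (PowerSeries.X : ℂ⟦X⟧) ^ n • f n (r n))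
      = ⟨y, hy⟩ - (PowerSeries.X : ℂ⟦X⟧) ^ N • r N := by
    intro N
    induction N with
    | zero =>
      simp [r]
    | succ N ih =>
      have h : (PowerSeries.X : ℂ⟦X⟧) ^ N • r N = (PowerSeries.X : ℂ⟦X⟧) ^ N •
          (f N (r N) + (HV.eulerOn L d.stable (f N (r N)) + (N : ℂ) • f N (r N)))
          + (PowerSeries.X : ℂ⟦X⟧) ^ (N + 1) • r (N + 1) := by
        nth_rw 1 [hfg N (r N)]
        rw [pow_succ, mul_smul, hr, ← smul_add]
        congr 1
        push_cast
        rw [add_smul, one_smul]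
        abel
      rw [Finset.sum_range_succ, map_add, add_add_add_comm, ih, hD, ← smul_add, h]
      abel
  -- The error is divisible by every power of q.
  have hlim : s + HV.eulerOn L d.stable s - ⟨y, hy⟩ = 0 := by
    refine PowerSeries.eq_zero_of_forall_X_pow_smul (k := ℂ) _ fun N => ?_
    obtain ⟨t, ht⟩ := hs N
    refine ⟨t + (HV.eulerOn L d.stable t + (N : ℂ) • t) - r N, ?_⟩
    rw [smul_sub, smul_add, ← hD]
    rw [ht, map_add, add_add_add_comm, hpart]
    abel
  exact ⟨s, s.2, congrArg Subtype.val (sub_eq_zero.mp hlim)⟩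

/-- An element of the Deligne lattice that is horizontal at `q = 0` lifts to a horizontal one. -/
theorem VHS.IsDeligneLattice.exists_horizontal {L : Submodule ℂ⟦X⟧ V}
    (d : HV.IsDeligneLattice L) {w : V}
    (h : HV.euler w ∈ (PowerSeries.X : ℂ⟦X⟧) • L) :
    ∃ u ∈ L, HV.euler (w + (PowerSeries.X : ℂ⟦X⟧) • u) = 0 := by
  obtain ⟨y, hy, hyw⟩ := mem_X_smul.mp h
  -- With Dw = qy and D(qu) = q(u + Du), flatness of w + qu amounts to u + Du = -y.
  obtain ⟨u, hu, huy⟩ := d.exists_add_euler_eq (neg_mem hy)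
  refine ⟨u, hu, ?_⟩
  rw [map_add, HV.euler_X_smul, huy, ← hyw, smul_neg, add_neg_cancel]

end Morphisms

/-! ### The trivial variation -/

lemma mem_integers {f : ℂ⸨X⸩} : f ∈ integers ↔ ∃ g : ℂ⟦X⟧, (g : ℂ⸨X⸩) = f := Iff.rfl

lemma trivialVHS_euler_coeff (m : ℤ) (f : ℂ⸨X⸩) (n : ℤ) :
    ((trivialVHS m).euler f).coeff n = n * f.coeff n := by
  rw [← coeff_q_mul_derivative, VHS.euler_apply, ← algebraMap_smul ℂ⸨X⸩,
    LaurentSeries.coe_algebraMap, HahnSeries.ofPowerSeries_X]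
  rfl

lemma coe_mem_X_smul_integers {g : ℂ⟦X⟧} (hg : PowerSeries.constantCoeff g = 0) :
    (g : ℂ⸨X⸩) ∈ (PowerSeries.X : ℂ⟦X⟧) • integers := by
  obtain ⟨k, rfl⟩ := PowerSeries.X_dvd_iff.mpr hg
  refine mem_X_smul.mpr ⟨(k : ℂ⸨X⸩), ⟨k, rfl⟩, ?_⟩
  rw [← algebraMap_smul ℂ⸨X⸩, LaurentSeries.coe_algebraMap, smul_eq_mul, map_mul]

lemma coe_constantCoeff (g : ℂ⟦X⟧) : (g : ℂ⸨X⸩).coeff 0 = PowerSeries.constantCoeff g := by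
  simpa using LaurentSeries.coeff_coe_powerSeries g 0

/-- The operator q d/dq kills constant terms, so the residue on ℂ[[q]] is zero. -/
lemma trivialVHS_euler_mem (m : ℤ) {f : ℂ⸨X⸩} (hf : f ∈ integers) :
    (trivialVHS m).euler f ∈ (PowerSeries.X : ℂ⟦X⟧) • integers := by
  obtain ⟨g, rfl⟩ := hf
  have h : (trivialVHS m).euler (g : ℂ⸨X⸩)
      = (PowerSeries.mk fun n => n * PowerSeries.coeff n g : ℂ⟦X⟧) := by
    ext n
    rw [trivialVHS_euler_coeff, PowerSeries.coeff_coe, PowerSeries.coeff_coe]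
    split_ifs with hn
    · simp
    · rw [PowerSeries.coeff_mk]
      lift n to ℕ using not_lt.mp hn
      simp
  exact h ▸ coe_mem_X_smul_integers (by simp)

theorem isDeligneLattice_integers (m : ℤ) : (trivialVHS m).IsDeligneLattice integers := by
  refine (VHS.isDeligneLattice_iff _).mpr ⟨⟨?_, ?_⟩, fun v hv => ?_, ?_⟩
  · exact Module.Finite.iff_fg.mp (Module.Finite.range (Algebra.linearMap ℂ⟦X⟧ ℂ⸨X⸩))
  · rw [eq_top_iff]
    intro f _
    have h1 : (1 : ℂ⸨X⸩) ∈ integers := ⟨1, by simp⟩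
    simpa using Submodule.smul_mem _ f (Submodule.subset_span (R := ℂ⸨X⸩) h1)
  · obtain ⟨u, hu, h⟩ := mem_X_smul.mp (trivialVHS_euler_mem m hv)
    exact h ▸ Submodule.smul_mem _ _ hu
  · rintro z ⟨v, hv, hv0, hvz⟩
    have h := sub_mem (trivialVHS_euler_mem m hv) hvz
    rw [sub_sub_cancel] at h
    suffices z = 0 by simp [this]
    by_contra hz
    refine hv0 ?_
    have h' := Submodule.smul_of_tower_mem _ z⁻¹ h
    rwa [inv_smul_smul₀ hz] at h'

end FormalVHS

/-! ### The residue sequence and its splitting -/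

theorem mainTheorem8
    {V W : Type*}
    [AddCommGroup V] [Module ℂ V] [Module ℂ⟦X⟧ V] [Module ℂ⸨X⸩ V]
    [IsScalarTower ℂ ℂ⟦X⟧ V] [IsScalarTower ℂ⟦X⟧ ℂ⸨X⸩ V]
    [AddCommGroup W] [Module ℂ W] [Module ℂ⟦X⟧ W] [Module ℂ⸨X⸩ W]
    [IsScalarTower ℂ ℂ⟦X⟧ W] [IsScalarTower ℂ⟦X⟧ ℂ⸨X⸩ W]
    (HV : FormalVHS.VHS V) (_PV : HV.Polarisation) (HW : FormalVHS.VHS W) (m : ℤ)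
    (a : V →ₗ[ℂ⸨X⸩] W) (b : W →ₗ[ℂ⸨X⸩] ℂ⸨X⸩)
    (_hab : FormalVHS.IsShortExact HV HW (FormalVHS.trivialVHS m) a b)
    (_hV : HV.IsRegularSingular) (_hW : HW.IsRegularSingular) :
    -- the Deligne lattices exist and are unique
    (∃! L : Submodule ℂ⟦X⟧ V, HV.IsDeligneLattice L) ∧
    (∃! L : Submodule ℂ⟦X⟧ W, HW.IsDeligneLattice L) ∧
    ∀ (LV : Submodule ℂ⟦X⟧ V) (LW : Submodule ℂ⟦X⟧ W)
      (dV : HV.IsDeligneLattice LV) (dW : HW.IsDeligneLattice LW),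
      ∃ (ha : ∀ v ∈ LV, a v ∈ LW) (hb : ∀ w ∈ LW, b w ∈ FormalVHS.integers),
        -- the residue sequence `0 → (LV₀, N) → (LW₀, M) → (ℂ, 0) → 0` is exact
        FormalVHS.IsExactEndo
          (HV.residue LV dV.stable) (HW.residue LW dW.stable) (0 : Module.End ℂ ℂ)
          (FormalVHS.fibreMap a LV LW ha) (FormalVHS.fibreMapToC b LW hb) ∧
        -- a flat section over `1` exists if and only if the residue sequence splits
        ((∃ h ∈ LW, HW.euler h = 0 ∧ b h = 1) ↔
          FormalVHS.SplitsEndo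
            (HW.residue LW dW.stable) (0 : Module.End ℂ ℂ)
            (FormalVHS.fibreMapToC b LW hb)) := by
  open FormalVHS in
  refine ⟨_hV.existsUnique_isDeligneLattice, _hW.existsUnique_isDeligneLattice,
    fun LV LW dV dW => ?_⟩
  have hae := map_euler_of_conn _hab.conn_left
  have hbe := map_euler_of_conn _hab.conn_right
  have dR := isDeligneLattice_integers m
  have hba : ∀ v, b (a v) = 0 := fun v => (_hab.exact _).mpr ⟨v, rfl⟩
  -- The image of a is the kernel of b, a ℂ((q))-subspace, so division by q stays inside it.
  have hcomap := dV.comap_eq dW hae _hab.injective (by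
    intro v w h
    refine (_hab.exact w).mp (X_smul_bijective.1 ?_)
    simp only
    rw [← LinearMap.map_smul_of_tower, ← h, hba, smul_zero])
  have hmap := dW.map_eq dR hbe _hab.surjective
  have hb : ∀ w ∈ LW, b w ∈ integers := fun w hw => (hmap _).mpr ⟨w, hw, rfl⟩
  refine ⟨fun v => (hcomap v).mpr, hb, ⟨?_, ?_, ?_, ?_, ?_⟩, ?_, ?_⟩
  · rw [injective_iff_map_eq_zero]
    intro x hx
    obtain ⟨v, rfl⟩ := toFibre_surjective LV x
    rw [fibreMap_toFibre, toFibre_eq_zero] at hx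
    obtain ⟨w, hw, hwv⟩ := mem_X_smul.mp hx
    obtain ⟨u, hu⟩ := X_smul_bijective.2 (v : V)
    simp only at hu
    have : a u = w := X_smul_bijective.1 (by
      simp only
      rw [hwv, ← LinearMap.map_smul_of_tower, hu])
    exact toFibre_eq_zero.mpr (mem_X_smul.mpr ⟨u, (hcomap u).mp (this ▸ hw), hu⟩)
  · intro x
    obtain ⟨w, rfl⟩ := toFibre_surjective LW x
    constructor
    · intro hx
      rw [fibreMapToC_toFibre] at hx
      obtain ⟨g, hg⟩ := mem_integers.mp (hb w w.2)
      rw [← hg, coe_constantCoeff] at hx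
      -- Here b(w) = qf; lifting f to w' in `LW`, the vector w - qw' has the same class as w and
      -- comes from `LV`.
      obtain ⟨f, hf, hfg⟩ := mem_X_smul.mp (coe_mem_X_smul_integers hx)
      obtain ⟨w', hw', rfl⟩ := (hmap f).mp hf
      obtain ⟨v, hv⟩ := (_hab.exact ((w : W) - (PowerSeries.X : ℂ⟦X⟧) • w')).mp (by
        rw [map_sub, LinearMap.map_smul_of_tower, hfg, hg, sub_self])
      have hvL : v ∈ LV := (hcomap v).mp (hv ▸ sub_mem w.2 (LW.smul_mem _ hw'))
      refine ⟨toFibre LV ⟨v, hvL⟩, ?_⟩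
      rw [fibreMap_toFibre, ← sub_eq_zero]
      refine toFibre_eq_zero (v := ⟨a v, (hcomap v).mpr hvL⟩ - w) |>.mpr (mem_X_smul.mpr
        ⟨-w', neg_mem hw', ?_⟩)
      change _ = a v - (w : W)
      rw [hv, smul_neg]
      abel
    · rintro ⟨y, hy⟩
      obtain ⟨v, rfl⟩ := toFibre_surjective LV y
      rw [← hy, fibreMap_toFibre, fibreMapToC_toFibre]
      simp [hba]
  · intro c
    obtain ⟨w, hw, hwc⟩ := (hmap (PowerSeries.C c : ℂ⟦X⟧)).mp ⟨_, rfl⟩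
    refine ⟨toFibre LW ⟨w, hw⟩, ?_⟩
    rw [fibreMapToC_toFibre, hwc, coe_constantCoeff]
    simp
  · refine LinearMap.ext fun x => ?_
    obtain ⟨v, rfl⟩ := toFibre_surjective LV x
    exact congrArg (toFibre LW) (Subtype.ext (hae v))
  · refine LinearMap.ext fun x => ?_
    obtain ⟨w, rfl⟩ := toFibre_surjective LW x
    rw [LinearMap.comp_apply, VHS.residue_toFibre, fibreMapToC_toFibre, hbe,
      trivialVHS_euler_coeff]
    simp
  · rintro ⟨h, hh, hh0, hh1⟩
    refine ⟨LinearMap.toSpanSingleton ℂ _ (toFibre LW ⟨h, hh⟩), ?_, ?_⟩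
    · refine LinearMap.ext_ring ?_
      rw [LinearMap.comp_apply, LinearMap.toSpanSingleton_apply, one_smul, fibreMapToC_toFibre,
        hh1]
      simp
    · refine LinearMap.ext_ring ?_
      rw [LinearMap.comp_apply, LinearMap.toSpanSingleton_apply, one_smul, VHS.residue_toFibre,
        LinearMap.comp_apply, LinearMap.zero_apply, map_zero]
      exact toFibre_eq_zero.mpr (by simp [hh0])
  · rintro ⟨s, hs, hM⟩
    obtain ⟨w, hw⟩ := toFibre_surjective LW (s 1)
    have h1 : (b w).coeff 0 = 1 := by
      rw [← fibreMapToC_toFibre b LW hb, hw]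
      exact LinearMap.congr_fun hs 1
    have h2 : HW.euler w ∈ (PowerSeries.X : ℂ⟦X⟧) • LW := by
      refine toFibre_eq_zero (v := ⟨HW.euler w, dW.stable w w.2⟩) |>.mp ?_
      rw [← VHS.residue_toFibre HW LW dW.stable w, hw]
      simpa using LinearMap.congr_fun hM 1
    obtain ⟨u, hu, hu0⟩ := dW.exists_horizontal h2
    have hL : (w : W) + (PowerSeries.X : ℂ⟦X⟧) • u ∈ LW := add_mem w.2 (LW.smul_mem _ hu)
    refine ⟨_, hL, hu0, ?_⟩
    -- The correction qu does not change the class in the fibre.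
    have h3 : (b ((w : W) + (PowerSeries.X : ℂ⟦X⟧) • u)).coeff 0 = 1 := by
      rw [← h1, ← fibreMapToC_toFibre b LW hb ⟨_, hL⟩, ← fibreMapToC_toFibre b LW hb w]
      congr 1
      rw [← sub_eq_zero]
      refine toFibre_eq_zero (v := ⟨_, hL⟩ - w) |>.mpr (mem_X_smul.mpr ⟨u, hu, ?_⟩)
      rw [AddSubgroupClass.coe_sub, add_sub_cancel_left]
    ext n
    by_cases hn : n = 0
    · rw [hn, h3]
      simp
    -- Flatness gives n · cₙ = 0 for the n-th coefficient cₙ of the image under b.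
    · have h4 := trivialVHS_euler_coeff m (b ((w : W) + (PowerSeries.X : ℂ⟦X⟧) • u)) n
      rw [← hbe, hu0, map_zero, HahnSeries.coeff_zero, eq_comm, mul_eq_zero] at h4
      rw [h4.resolve_left (by exact_mod_cast hn), HahnSeries.coeff_one, if_neg hn]
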